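/- **Setting.** Let $(H,\langle\cdot,\cdot\rangle,\|\cdot\|)$ be a real separable infinite-dimensional Hilbert space and let $(A,\mathcal D(A))$ be a self-adjoint operator on $H$ generating an immediately compact $C_0$-semigroup $(e^{tA})_{t\ge0}$ with $\|e^{tA}\|\le e^{-\alpha t}$ for all $t\ge 0$ and some $\alpha>0$. Let $(e_i)_{i\ge1}$ be an orthonormal basis of $H$ with $e_i\in\mathcal D(A)$ and $Ae_i=-\lambda_ie_i$, where $\lambda_1\le\lambda_2\le\cdots$. Let $b:H\to H$ be Lipschitz continuous and let $\sigma(x)=\sigma^0+\sigma^1(x)$, where $\sigma^0$ is a bounded linear operator on $H$ and $\sigma^1$ is a Lipschitz map from $H$ into the Hilbert–Schmidt operators on $H$ with the Hilbert–Schmidt norm. Let $W$ be an $H$-valued cylindrical $\mathrm{id}_H$-Wiener process on a filtered probability space $(\Omega,\mathcal F,(\mathcal F_t)_{t\ge0},\mathbb P)$. For $n\in\mathbb N$ let $H_n=\mathrm{span}\{e_1,\dots,e_n\}\cong\mathbb R^n$, let $\pi_n:H\to H_n$ be the orthogonal projection, and put $A_n=\pi_nA|_{H_n}$, $b_n=\pi_nb$,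 $\sigma_n=\pi_n\sigma$. For a stepsize $\Delta\in(0,1)$ and $x\in H_n$, the discrete exponential integrator scheme is the chain $(Y_x(k))_{k\ge0}$ in $H_n$ given by $Y_x(0)=x$ and $$Y_x(k+1)=e^{\Delta A_n}\Big\{Y_x(k)+b_n(Y_x(k))\,\Delta+\sigma_n(Y_x(k))\big(W((k+1)\Delta)-W(k\Delta)\big)\Big\},$$ where all the chains $Y_x$, $x\in H_n$, are driven by the same $W$. Write $P_k(x,\Gamma)=\mathbb P(Y_x(k)\in\Gamma)$ for Borel sets $\Gamma\subseteq H_n$. For probability measures $P,Q$ on $H_n$ let $$d_{\mathbb L}(P,Q)=\sup\Big\{\Big|\int f\,dP-\int f\,dQ\Big| : f:H_n\to\mathbb R,\ |f(u)-f(v)|\le\|u-v\|,\ |f|\le1\Big\}.$$ A probability measure $\pi$ on $H_n$ is called a *stationary distribution* of the scheme if $\lim_{k\to\infty}d_{\mathbb L}(P_k(x,\cdot),\pi)=0$ for every $x\in H_n$. **Theorem.** Fix $n$ and $\Delta\in(0,1)$, and assume that for every bounded set $U\subseteq H_n$ (P1) $\ \sup_{k\ge0}\sup_{x\in U}\mathbb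 E\|Y_x(k)\|^2<\infty$, and (P2) $\ \lim_{k\to\infty}\sup_{x,y\in U}\mathbb E\|Y_x(k)-Y_y(k)\|^2=0$. Then the scheme has a unique stationary distribution $\pi^{n,\Delta}$: there is exactly one probability measure $\pi^{n,\Delta}$ on $H_n$ such that $\lim_{k\to\infty}d_{\mathbb L}(P_k(x,\cdot),\pi^{n,\Delta})=0$ for every $x\in H_n$. -/

import Mathlib

open MeasureTheory ProbabilityTheory Filter Topology
open scoped NNReal ENNReal

namespace EIScheme

noncomputable section

/-- The exponential of a bounded operator. -/
def opExp {E : Type*} [NormedAddCommGroup E] [NormedSpace ℝ E] (T : E →L[ℝ] E) : E →L[ℝ] E :=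
  NormedSpace.exp T

section Operators

variable {H : Type*} [NormedAddCommGroup H] [InnerProductSpace ℝ H]

/-- `S` is a strongly continuous semigroup of bounded operators on `H`. -/
structure IsC0Semigroup (S : ℝ≥0 → H →L[ℝ] H) : Prop where
  map_zero : S 0 = ContinuousLinearMap.id ℝ H
  map_add : ∀ s t, S (s + t) = (S s).comp (S t)
  tendsto_zero : ∀ x, Tendsto (fun t => S t x) (𝓝[>] 0) (𝓝 x)

/-- The (unbounded) operator `A` is the infinitesimal generator of `S`: `x ∈ D(A)` and `A x = y`
exactly when `(S t x - x) / t` converges to `y` as `t ↓ 0`. -/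
def IsGenerator (A : H →ₗ.[ℝ] H) (S : ℝ≥0 → H →L[ℝ] H) : Prop :=
  ∀ x y : H, (x, y) ∈ A.graph ↔
    Tendsto (fun t : ℝ≥0 => (t : ℝ)⁻¹ • (S t x - x)) (𝓝[>] 0) (𝓝 y)

/-- `A` is a self-adjoint operator generating an immediately compact `C₀`-semigroup `S` with
`‖S t‖ ≤ exp (-α t)` for some `α > 0`, and `e` is an orthonormal eigenbasis of `H`, where `lam i`
is the eigenvalue of `-A` belonging to `e i`, in nondecreasing order. (That the `lam i` are
positive and tend to infinity is a consequence.) -/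
structure LinearPartAssumption [CompleteSpace H] (A : H →ₗ.[ℝ] H) (S : ℝ≥0 → H →L[ℝ] H)
    (lam : ℕ → ℝ) (e : HilbertBasis ℕ ℝ H) : Prop where
  selfAdjoint : IsSelfAdjoint A
  semigroup : IsC0Semigroup S
  generator : IsGenerator A S
  immediatelyCompact : ∀ t, 0 < t → IsCompactOperator (S t)
  decay : ∃ α : ℝ, 0 < α ∧ ∀ t : ℝ≥0, ‖S t‖ ≤ Real.exp (-α * t)
  eigen_mem : ∀ i, e i ∈ A.domain
  eigen : ∀ i, A ⟨e i, eigen_mem i⟩ = -lam i • e i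
  mono : Monotone lam

/-- The squared Hilbert–Schmidt norm `∑ i, ‖T (e i)‖ ^ 2` (it does not depend on the orthonormal
basis `e`); it is finite exactly when `T` is a Hilbert–Schmidt operator. -/
def hsNormSq (e : HilbertBasis ℕ ℝ H) (T : H →L[ℝ] H) : ℝ≥0∞ := ∑' i, ‖T (e i)‖ₑ ^ 2

/-- `b` is Lipschitz; `σ₁` takes values in the Hilbert–Schmidt operators and is Lipschitz in the
Hilbert–Schmidt norm. -/
structure CoefficientAssumption (e : HilbertBasis ℕ ℝ H) (b : H → H) (σ₁ : H → H →L[ℝ] H) :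
    Prop where
  lipschitz_b : ∃ L₁ : ℝ, 0 < L₁ ∧ ∀ x y, ‖b x - b y‖ ≤ L₁ * ‖x - y‖
  hilbertSchmidt : ∀ x, hsNormSq e (σ₁ x) < ∞
  lipschitz_σ₁ : ∃ L₂ : ℝ, 0 < L₂ ∧
    ∀ x y, hsNormSq e (σ₁ x - σ₁ y) ≤ ENNReal.ofReal ((L₂ * ‖x - y‖) ^ 2)

/-- `H_n`, the span of the first `n` basis vectors. -/
def Hn (e : HilbertBasis ℕ ℝ H) (n : ℕ) : Submodule ℝ H :=
  Submodule.span ℝ (Set.range fun i : Fin n => e i)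

instance (e : HilbertBasis ℕ ℝ H) (n : ℕ) : FiniteDimensional ℝ (Hn e n) :=
  FiniteDimensional.span_of_finite ℝ (Set.finite_range _)

/-- The orthogonal projection `π_n : H → H_n`. -/
def proj (e : HilbertBasis ℕ ℝ H) (n : ℕ) : H →L[ℝ] Hn e n := (Hn e n).orthogonalProjectionOnto

theorem Hn_le_domain {A : H →ₗ.[ℝ] H} {e : HilbertBasis ℕ ℝ H} (he : ∀ i, e i ∈ A.domain)
    (n : ℕ) : Hn e n ≤ A.domain :=
  Submodule.span_le.2 (by rintro _ ⟨i, rfl⟩; exact he i)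

/-- `A_n = π_n A`, a bounded operator on `H_n ⊆ D(A)`. -/
def An (A : H →ₗ.[ℝ] H) (e : HilbertBasis ℕ ℝ H) (he : ∀ i, e i ∈ A.domain) (n : ℕ) :
    Hn e n →L[ℝ] Hn e n :=
  LinearMap.toContinuousLinearMap
    ((proj e n).toLinearMap ∘ₗ A.toFun ∘ₗ Submodule.inclusion (Hn_le_domain he n))

end Operators

section Noise

variable {H : Type*} [NormedAddCommGroup H] [InnerProductSpace ℝ H]
  {Ω : Type*} {mΩ : MeasurableSpace Ω}

/-- `W` is an `H`-valued cylindrical `id_H`-Wiener process with respect to the filtration `𝓕`;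
`W t h` is the real random variable usually written `⟨W(t), h⟩`. -/
structure IsCylindricalWiener (𝓕 : Filtration ℝ≥0 mΩ) (P : Measure Ω)
    (W : ℝ≥0 → H → Ω → ℝ) : Prop where
  adapted : ∀ t h, Measurable[𝓕 t] (W t h)
  zero : ∀ h, ∀ᵐ ω ∂P, W 0 h ω = 0
  linear : ∀ t (a : ℝ) g h, ∀ᵐ ω ∂P, W t (a • g + h) ω = a * W t g ω + W t h ω
  continuous : ∀ h, ∀ᵐ ω ∂P, Continuous fun t => W t h ω
  gaussian : ∀ s t, s ≤ t → ∀ h,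
    P.map (fun ω => W t h ω - W s h ω) = gaussianReal 0 ((t - s) * ‖h‖₊ ^ 2)
  /-- The increment over `[s, t]`, as the family of all its coordinates, is independent of the
  past `𝓕 s`. -/
  indep : ∀ s t, s ≤ t →
    Indep (MeasurableSpace.comap (fun ω (h : H) => W t h ω - W s h ω) MeasurableSpace.pi) (𝓕 s) P

/-- `π_n T ξ` for a bounded operator `T` and a cylindrical increment `ξ`, where `ξ h` stands for
`⟨ξ, h⟩`: the limit of the partial sums of `∑ j, ⟨ξ, e_j⟩ π_n T e_j`. For a fixed `T`, or a random
`T` independent of the white noise `ξ`, this is a series of (conditionally) independent centred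
Gaussian vectors of the finite-dimensional space `H_n` with summable variances, so that it
converges almost surely. -/
def applyNoise (e : HilbertBasis ℕ ℝ H) (n : ℕ) (T : H →L[ℝ] H) (ξ : H → ℝ) : Hn e n :=
  limUnder atTop fun m : ℕ => ∑ j ∈ Finset.range m, ξ (e j) • proj e n (T (e j))

/-- The discrete exponential integrator scheme: `scheme … x k` is the approximation at time `k Δ`
started from `x ∈ H_n`,
`Y_{k+1} = exp (Δ A_n) {Y_k + b_n(Y_k) Δ + σ_n(Y_k) (W((k+1)Δ) - W(kΔ))}`, with `b_n = π_n b` and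
`σ_n = π_n σ`. -/
def scheme (A : H →ₗ.[ℝ] H) (e : HilbertBasis ℕ ℝ H) (he : ∀ i, e i ∈ A.domain)
    (b : H → H) (σ : H → H →L[ℝ] H) (W : ℝ≥0 → H → Ω → ℝ) (n : ℕ) (Δ : ℝ≥0) (x : Hn e n) :
    ℕ → Ω → Hn e n
  | 0 => fun _ => x
  | k + 1 => fun ω =>
    let y := scheme A e he b σ W n Δ x k ω
    opExp ((Δ : ℝ) • An A e he n)
      (y + (Δ : ℝ) • proj e n (b y) +
        applyNoise e n (σ y) fun h => W ((k + 1 : ℕ) * Δ) h ω - W (k * Δ) h ω)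

end Noise

section Laws

variable {K : Type*} [NormedAddCommGroup K] {Ω : Type*} {mΩ : MeasurableSpace Ω}

/-- The bounded-Lipschitz distance: the supremum of `|∫ f dP₁ - ∫ f dP₂|` over all `f : K → ℝ` with
`|f u - f v| ≤ ‖u - v‖` and `|f| ≤ 1`. -/
def dL [MeasurableSpace K] (P₁ P₂ : Measure K) : ℝ :=
  ⨆ f : {f : K → ℝ // (∀ u v, |f u - f v| ≤ ‖u - v‖) ∧ ∀ u, |f u| ≤ 1},
    |∫ u, f.1 u ∂P₁ - ∫ u, f.1 u ∂P₂|

/-- Property (P1) of a family of chains `Y x`, `x` the starting point: for every bounded set `U` of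
starting points, `sup_k sup_{x ∈ U} E ‖Y x k‖ ^ 2 < ∞`. -/
def PropertyP1 (P : Measure Ω) (Y : K → ℕ → Ω → K) : Prop :=
  ∀ U : Set K, Bornology.IsBounded U → (⨆ k, ⨆ x ∈ U, ∫⁻ ω, ‖Y x k ω‖ₑ ^ 2 ∂P) < ∞

/-- Property (P2): for every bounded set `U` of starting points,
`sup_{x, y ∈ U} E ‖Y x k - Y y k‖ ^ 2 → 0` as `k → ∞`. -/
def PropertyP2 (P : Measure Ω) (Y : K → ℕ → Ω → K) : Prop :=
  ∀ U : Set K, Bornology.IsBounded U →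
    Tendsto (fun k => ⨆ x ∈ U, ⨆ y ∈ U, ∫⁻ ω, ‖Y x k ω - Y y k ω‖ₑ ^ 2 ∂P) atTop (𝓝 0)

/-- `π` is a stationary distribution of the family of chains `Y`: from every starting point `x` the
`k`-step laws `P (Y x k ∈ ·)` converge to `π` in the bounded-Lipschitz distance. -/
def IsStationaryDistribution [MeasurableSpace K] (P : Measure Ω) (Y : K → ℕ → Ω → K)
    (π : ProbabilityMeasure K) : Prop :=
  ∀ x, Tendsto (fun k => dL (P.map (Y x k)) (π : Measure K)) atTop (𝓝 0)

end Laws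

end

end EIScheme

/-! Fix `x` and a test function `f`, and put `u y = E f(Y_y(k))`. By the Markov property `E
f(Y_x(k+l)) = E u(Y_x(l))`. For large `k`, (P2) makes `u` nearly constant on a given ball, uniformly
in `f`; (P1) keeps `Y_x(l)` in a ball with high probability, uniformly in `l`. Hence the laws of
`Y_x(k)` are Cauchy in `dL`. By (P1) they are also tight, so Prokhorov's theorem yields a weak limit
point, and the Cauchy property turns it into a `dL`-limit (`exists_tendsto_dL`). By (P2) the limit
does not depend on `x`; uniqueness holds because weak limits are unique.

The Markov property (`markov_of_random_iteration`) holds because each step applies one fixed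
measurable map to the state and a noise increment that is independent of the past and has the same
law at every step (`IsCylindricalWiener.map_increment_eq`). -/

namespace EIScheme

/-! ### The bounded-Lipschitz distance and weak convergence. -/

section BoundedLipschitzDistance

theorem continuous_of_abs_sub_le_norm {K : Type*} [NormedAddCommGroup K] {f : K → ℝ}
    (hf : ∀ u v, |f u - f v| ≤ ‖u - v‖) : Continuous f :=
  (LipschitzWith.of_dist_le_mul (K := 1) fun u v => by
    simpa [Real.dist_eq, dist_eq_norm] using hf u v).continuous

theorem integrable_of_measurable_of_abs_le_one {X : Type*} [MeasurableSpace X] {μ : Measure X}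
    [IsProbabilityMeasure μ] {f : X → ℝ} (hf : Measurable f) (h1 : ∀ u, |f u| ≤ 1) :
    Integrable f μ :=
  Integrable.of_bound hf.aestronglyMeasurable 1 (ae_of_all _ h1)

theorem abs_integral_le_one {X : Type*} [MeasurableSpace X] {μ : Measure X}
    [IsProbabilityMeasure μ] {f : X → ℝ} (h1 : ∀ u, |f u| ≤ 1) : |∫ u, f u ∂μ| ≤ 1 := by
  simpa using norm_integral_le_of_norm_le_const (μ := μ) (f := f) (ae_of_all _ h1)

variable {K : Type*} [NormedAddCommGroup K] [MeasurableSpace K]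

theorem abs_integral_sub_le_dL (μ ν : Measure K) [IsProbabilityMeasure μ] [IsProbabilityMeasure ν]
    {f : K → ℝ} (hf : ∀ u v, |f u - f v| ≤ ‖u - v‖) (h1 : ∀ u, |f u| ≤ 1) :
    |∫ u, f u ∂μ - ∫ u, f u ∂ν| ≤ dL μ ν := by
  -- A real supremum is an upper bound only for a bounded family; here 2 bounds it.
  refine le_ciSup (f := fun f : {f : K → ℝ // (∀ u v, |f u - f v| ≤ ‖u - v‖) ∧ ∀ u, |f u| ≤ 1} =>
    |∫ u, f.1 u ∂μ - ∫ u, f.1 u ∂ν|) ⟨2, ?_⟩ ⟨f, hf, h1⟩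
  rintro _ ⟨g, rfl⟩
  have h₁ := abs_integral_le_one (μ := μ) g.2.2
  have h₂ := abs_integral_le_one (μ := ν) g.2.2
  rw [abs_le] at *
  constructor <;> linarith

theorem dL_le {μ ν : Measure K} {c : ℝ}
    (h : ∀ f : K → ℝ, (∀ u v, |f u - f v| ≤ ‖u - v‖) → (∀ u, |f u| ≤ 1) →
      |∫ u, f u ∂μ - ∫ u, f u ∂ν| ≤ c) : dL μ ν ≤ c := by
  have : Nonempty {f : K → ℝ // (∀ u v, |f u - f v| ≤ ‖u - v‖) ∧ ∀ u, |f u| ≤ 1} :=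
    ⟨fun _ => 0, by simp, by simp⟩
  exact ciSup_le fun f => h f.1 f.2.1 f.2.2

theorem dL_nonneg (μ ν : Measure K) : 0 ≤ dL μ ν :=
  Real.iSup_nonneg fun _ => abs_nonneg _

variable [BorelSpace K]

theorem tendsto_of_tendsto_dL {μ : ℕ → ProbabilityMeasure K} {π : ProbabilityMeasure K}
    (h : Tendsto (fun k => dL (μ k : Measure K) π) atTop (𝓝 0)) : Tendsto μ atTop (𝓝 π) := by
  rw [tendsto_iff_forall_lipschitz_integral_tendsto]
  rintro f ⟨C, hC⟩ ⟨L, hL⟩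
  have hC0 : 0 ≤ C := dist_nonneg.trans (hC 0 0)
  -- `M` dominates the Lipschitz constant `L` and the bound `|f 0| + C` of `|f|`, so `M⁻¹ * f` is
  -- admissible in `dL`.
  obtain ⟨M, hM, hM0⟩ : ∃ M : ℝ, M = 1 + L + |f 0| + C ∧ 0 < M := ⟨_, rfl, by positivity⟩
  have key : ∀ k, |∫ u, f u ∂(μ k : Measure K) - ∫ u, f u ∂(π : Measure K)|
      ≤ M * dL (μ k : Measure K) π := by
    intro k
    have h1 := abs_integral_sub_le_dL (μ k : Measure K) (π : Measure K) (f := fun u => M⁻¹ * f u)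
      (fun u v => by
        rw [← mul_sub, abs_mul, abs_of_pos (inv_pos.2 hM0), inv_mul_le_iff₀ hM0]
        have := hL.dist_le_mul u v
        rw [Real.dist_eq, dist_eq_norm] at this
        refine this.trans (mul_le_mul_of_nonneg_right ?_ (norm_nonneg _))
        linarith [abs_nonneg (f 0)])
      (fun u => by
        rw [abs_mul, abs_of_pos (inv_pos.2 hM0), inv_mul_le_iff₀ hM0]
        have h2 := hC u 0
        rw [Real.dist_eq] at h2
        have h3 := abs_sub_abs_le_abs_sub (f u) (f 0)
        have h4 := L.2
        simp only [NNReal.val_eq_coe] at h4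
        linarith)
    rwa [integral_const_mul, integral_const_mul, ← mul_sub, abs_mul,
      abs_of_pos (inv_pos.2 hM0), inv_mul_le_iff₀ hM0] at h1
  rw [tendsto_iff_dist_tendsto_zero]
  refine squeeze_zero (fun _ => dist_nonneg) key ?_
  simpa using h.const_mul M

/-- Prokhorov gives a weakly convergent subsequence. The Cauchy bound is uniform over test
functions, so passing to the limit along that subsequence for each `f` separately bounds `dL`
itself. -/
theorem exists_tendsto_dL [SecondCountableTopology K] [ProperSpace K]
    {μ : ℕ → ProbabilityMeasure K}
    (htight : IsTightMeasureSet (Set.range fun k => (μ k : Measure K)))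
    (hcauchy : ∀ ε > 0, ∃ N, ∀ k ≥ N, ∀ l, dL (μ (k + l) : Measure K) (μ k) ≤ ε) :
    ∃ π : ProbabilityMeasure K, Tendsto (fun k => dL (μ k : Measure K) π) atTop (𝓝 0) := by
  have hc : IsCompact (closure (Set.range μ)) := by
    refine isCompact_closure_of_isTightMeasureSet (htight.subset ?_)
    rintro _ ⟨_, ⟨k, rfl⟩, rfl⟩
    exact ⟨k, rfl⟩
  obtain ⟨π, -, φ, hφ, hlim⟩ := hc.tendsto_subseq fun k => subset_closure (Set.mem_range_self k)
  rw [tendsto_iff_forall_lipschitz_integral_tendsto] at hlim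
  refine ⟨π, Metric.tendsto_atTop.2 fun ε hε => ?_⟩
  obtain ⟨N, hN⟩ := hcauchy (ε / 2) (half_pos hε)
  refine ⟨N, fun k hk => ?_⟩
  rw [Real.dist_eq, sub_zero, abs_of_nonneg (dL_nonneg _ _)]
  refine lt_of_le_of_lt (dL_le fun f hf h1 => ?_) (half_lt_self hε)
  have hl := hlim f ⟨2, fun x y => by
      rw [Real.dist_eq]
      have hx := abs_le.1 (h1 x)
      have hy := abs_le.1 (h1 y)
      exact abs_le.2 ⟨by linarith, by linarith⟩⟩
    ⟨1, LipschitzWith.of_dist_le_mul fun u v => by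
      simpa [Real.dist_eq, dist_eq_norm] using hf u v⟩
  refine le_of_tendsto ((tendsto_const_nhds.sub hl).abs) ?_
  filter_upwards [eventually_ge_atTop k] with j hj
  obtain ⟨l, hl⟩ := Nat.exists_eq_add_of_le (hj.trans (hφ.id_le j))
  have h2 := abs_integral_sub_le_dL (μ (k + l) : Measure K) (μ k : Measure K) hf h1
  rw [abs_sub_comm] at h2
  have h3 := h2.trans (hN k hk l)
  simp only [Function.comp_apply] at hl ⊢
  rwa [hl]

end BoundedLipschitzDistance

/-! ### Markov chains with properties (P1) and (P2). -/

section MarkovChain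

theorem PropertyP1.exists_radius {Ω : Type*} {mΩ : MeasurableSpace Ω} {P : Measure Ω}
    {K : Type*} [NormedAddCommGroup K] [MeasurableSpace K] [BorelSpace K] {Y : K → ℕ → Ω → K}
    (hY : ∀ x k, Measurable (Y x k)) (hP1 : PropertyP1 P Y) (x : K) {ε : ℝ} (hε : 0 < ε) :
    ∃ R : ℝ, 0 < R ∧ ∀ r ≥ R, ∀ k, P {ω | r < ‖Y x k ω‖} ≤ ENNReal.ofReal ε := by
  have hfin := hP1 {x} Bornology.isBounded_singleton
  set C := ⨆ k, ⨆ x' ∈ ({x} : Set K), ∫⁻ ω, ‖Y x' k ω‖ₑ ^ 2 ∂P with hC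
  have hle : ∀ k, ∫⁻ ω, ‖Y x k ω‖ₑ ^ 2 ∂P ≤ C := fun k =>
    le_trans (by simp) (le_iSup (fun k => ⨆ x' ∈ ({x} : Set K), ∫⁻ ω, ‖Y x' k ω‖ₑ ^ 2 ∂P) k)
  have hR0 : 0 < 1 + C.toReal / ε := by positivity
  -- The summand 1 gives `r ^ 2 ≥ r ≥ C / ε`, as Chebyshev's inequality requires, without a square
  -- root.
  refine ⟨1 + C.toReal / ε, hR0, fun r hr k => ?_⟩
  have hr0 : 0 < r := hR0.trans_le hr
  have hr2 : C.toReal / ε ≤ r ^ 2 := by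
    have : 0 ≤ C.toReal / ε := by positivity
    nlinarith
  have hmarkov := mul_meas_ge_le_lintegral (μ := P) (f := fun ω => ‖Y x k ω‖ₑ ^ 2)
    ((hY x k).enorm.pow_const 2) (ENNReal.ofReal (r ^ 2))
  have hsub : {ω | r < ‖Y x k ω‖} ⊆ {ω | ENNReal.ofReal (r ^ 2) ≤ ‖Y x k ω‖ₑ ^ 2} := by
    intro ω (hω : r < ‖Y x k ω‖)
    rw [Set.mem_ofPred_eq, ENNReal.ofReal_pow hr0.le, ← ofReal_norm]
    gcongr
  have hr2' : ENNReal.ofReal (r ^ 2) ≠ 0 := by simpa using by positivity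
  refine (measure_mono hsub).trans ?_
  rw [mul_comm, ← ENNReal.le_div_iff_mul_le (Or.inl hr2') (Or.inl ENNReal.ofReal_ne_top)] at hmarkov
  refine hmarkov.trans (ENNReal.div_le_of_le_mul ((hle k).trans ?_))
  rw [← ENNReal.ofReal_mul hε.le, ENNReal.le_ofReal_iff_toReal_le hfin.ne (by positivity)]
  rwa [div_le_iff₀' hε] at hr2

variable {Ω : Type*} {mΩ : MeasurableSpace Ω} {P : Measure Ω} [IsProbabilityMeasure P]

/-- The Markov property of a family of chains given by iterated random maps. -/
theorem markov_of_random_iteration {K Z : Type*} [MeasurableSpace K] [MeasurableSpace Z]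
    {F : K × Z → K} (hF : Measurable F) {ξ : ℕ → Ω → Z} (hξ : ∀ k, Measurable (ξ k))
    {Y : K → ℕ → Ω → K} (hY : ∀ x k, Measurable (Y x k)) (h0 : ∀ x ω, Y x 0 ω = x)
    (hsucc : ∀ x k ω, Y x (k + 1) ω = F (Y x k ω, ξ k ω))
    (hlaw : ∀ k, P.map (ξ k) = P.map (ξ 0))
    (hind : ∀ x k, IndepFun (Y x k) (ξ k) P)
    (k : ℕ) {f : K → ℝ} (hf : Measurable f) (h1 : ∀ u, |f u| ≤ 1) :
    Measurable (fun y => ∫ ω, f (Y y k ω) ∂P) ∧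
      ∀ l x, ∫ ω, f (Y x (k + l) ω) ∂P = ∫ ω, ∫ ω', f (Y (Y x l ω) k ω') ∂P ∂P := by
  have : IsProbabilityMeasure (P.map (ξ 0)) := Measure.isProbabilityMeasure_map (hξ 0).aemeasurable
  -- The last step is integrated out, and the induction hypothesis is applied to the resulting
  -- function of the state. Measurability in the starting point comes from that of `F`; joint
  -- measurability of `Y` in `(y, ω)` is never needed.
  induction k generalizing f with
  | zero => simpa [h0] using hf
  | succ k ih =>
    have hstep : ∀ x j, ∫ ω, f (Y x (j + 1) ω) ∂P =
        ∫ ω, ∫ z, f (F (Y x j ω, z)) ∂(P.map (ξ 0)) ∂P := by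
      intro x j
      have := Measure.isProbabilityMeasure_map (μ := P) (hY x j).aemeasurable
      have hm := (indepFun_iff_map_prod_eq_prod_map_map (hY x j).aemeasurable
        (hξ j).aemeasurable).1 (hind x j)
      rw [hlaw j] at hm
      have hfF : Measurable fun p => f (F p) := hf.comp hF
      calc ∫ ω, f (Y x (j + 1) ω) ∂P = ∫ ω, f (F (Y x j ω, ξ j ω)) ∂P := by simp_rw [hsucc]
        _ = ∫ p, f (F p) ∂(P.map fun ω => (Y x j ω, ξ j ω)) :=
          (integral_map ((hY x j).prodMk (hξ j)).aemeasurable hfF.aestronglyMeasurable).symm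
        _ = ∫ y, ∫ z, f (F (y, z)) ∂(P.map (ξ 0)) ∂(P.map (Y x j)) := by
          rw [hm, integral_prod _ (integrable_of_measurable_of_abs_le_one hfF fun p => h1 _)]
        _ = _ := integral_map (hY x j).aemeasurable
          (StronglyMeasurable.integral_prod_right (f := fun y z => f (F (y, z)))
            hfF.stronglyMeasurable).aestronglyMeasurable
    have hT : Measurable fun y => ∫ z, f (F (y, z)) ∂(P.map (ξ 0)) :=
      (StronglyMeasurable.integral_prod_right (f := fun y z => f (F (y, z)))
        (hf.comp hF).stronglyMeasurable).measurable
    obtain ⟨hm, hc⟩ := ih hT fun y => abs_integral_le_one fun z => h1 _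
    refine ⟨by simpa only [hstep] using hm, fun l x => ?_⟩
    simp only [hstep]
    rw [← hc l x, ← hstep]
    congr! 4
    omega

variable {K : Type*} [NormedAddCommGroup K] [MeasurableSpace K] [BorelSpace K]

/-- On a probability space the `L¹` norm is at most the `L²` norm, and `f` is 1-Lipschitz. -/
theorem abs_integral_sub_le_of_lintegral_sq_le {X Y : Ω → K} (hX : Measurable X)
    (hY : Measurable Y) {f : K → ℝ} (hf : ∀ u v, |f u - f v| ≤ ‖u - v‖) (h1 : ∀ u, |f u| ≤ 1)
    {ε : ℝ} (hε : 0 ≤ ε) (h : ∫⁻ ω, ‖X ω - Y ω‖ₑ ^ 2 ∂P ≤ ENNReal.ofReal (ε ^ 2)) :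
    |∫ ω, f (X ω) ∂P - ∫ ω, f (Y ω) ∂P| ≤ ε := by
  have hfm := (continuous_of_abs_sub_le_norm hf).measurable
  have hg : Measurable fun ω => f (X ω) - f (Y ω) := (hfm.comp hX).sub (hfm.comp hY)
  have hsub : ∫ ω, f (X ω) ∂P - ∫ ω, f (Y ω) ∂P = ∫ ω, (f (X ω) - f (Y ω)) ∂P :=
    (integral_sub (integrable_of_measurable_of_abs_le_one (hfm.comp hX) fun ω => h1 _)
      (integrable_of_measurable_of_abs_le_one (hfm.comp hY) fun ω => h1 _)).symm
  rw [hsub]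
  have hle : ‖∫ ω, (f (X ω) - f (Y ω)) ∂P‖ₑ ≤ ENNReal.ofReal ε := by
    calc ‖∫ ω, (f (X ω) - f (Y ω)) ∂P‖ₑ ≤ ∫⁻ ω, ‖f (X ω) - f (Y ω)‖ₑ ∂P :=
          enorm_integral_le_lintegral_enorm _
      _ = eLpNorm (fun ω => f (X ω) - f (Y ω)) 1 P := eLpNorm_one_eq_lintegral_enorm.symm
      _ ≤ eLpNorm (fun ω => f (X ω) - f (Y ω)) 2 P :=
          eLpNorm_le_eLpNorm_of_exponent_le (by norm_num) hg.aestronglyMeasurable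
      _ = (∫⁻ ω, ‖f (X ω) - f (Y ω)‖ₑ ^ 2 ∂P) ^ (1 / 2 : ℝ) := by
          simp [eLpNorm_eq_lintegral_rpow_enorm_toReal]
      _ ≤ (∫⁻ ω, ‖X ω - Y ω‖ₑ ^ 2 ∂P) ^ (1 / 2 : ℝ) := by
          gcongr with ω
          rw [enorm_le_iff_norm_le]
          exact hf _ _
      _ ≤ (ENNReal.ofReal (ε ^ 2)) ^ (1 / 2 : ℝ) := by gcongr
      _ = ENNReal.ofReal ε := by
          rw [ENNReal.ofReal_rpow_of_nonneg (by positivity) (by positivity),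
            ← Real.sqrt_eq_rpow, Real.sqrt_sq hε]
  rw [← ofReal_norm, ENNReal.ofReal_le_ofReal_iff hε] at hle
  exact hle

/-- The threshold for `k` precedes `f`: estimates of `dL` need this uniformity. -/
theorem PropertyP2.eventually_abs_integral_sub_le {Y : K → ℕ → Ω → K}
    (hY : ∀ x k, Measurable (Y x k)) (hP2 : PropertyP2 P Y) {U : Set K}
    (hU : Bornology.IsBounded U) {ε : ℝ} (hε : 0 < ε) :
    ∀ᶠ k in atTop, ∀ f : K → ℝ, (∀ u v, |f u - f v| ≤ ‖u - v‖) → (∀ u, |f u| ≤ 1) →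
      ∀ x ∈ U, ∀ y ∈ U, |∫ ω, f (Y x k ω) ∂P - ∫ ω, f (Y y k ω) ∂P| ≤ ε := by
  filter_upwards [(hP2 U hU).eventually_le_const
    (u := ENNReal.ofReal (ε ^ 2)) (by simpa using by positivity)] with k hk f hf h1 x hx y hy
  refine abs_integral_sub_le_of_lintegral_sq_le (hY x k) (hY y k) hf h1 hε.le (le_trans ?_ hk)
  exact le_iSup₂_of_le x hx (le_iSup₂_of_le (f := fun y _ =>
    ∫⁻ ω, ‖Y x k ω - Y y k ω‖ₑ ^ 2 ∂P) y hy le_rfl)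

/-- A family of Markov chains with properties (P1) and (P2) has a unique stationary
distribution. -/
theorem existsUnique_isStationaryDistribution [SecondCountableTopology K] [ProperSpace K]
    {Y : K → ℕ → Ω → K} (hY : ∀ x k, Measurable (Y x k))
    (hmeas : ∀ k (f : K → ℝ), Measurable f → (∀ u, |f u| ≤ 1) →
      Measurable fun y => ∫ ω, f (Y y k ω) ∂P)
    (hmarkov : ∀ k l x (f : K → ℝ), Measurable f → (∀ u, |f u| ≤ 1) →
      ∫ ω, f (Y x (k + l) ω) ∂P = ∫ ω, ∫ ω', f (Y (Y x l ω) k ω') ∂P ∂P)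
    (hP1 : PropertyP1 P Y) (hP2 : PropertyP2 P Y) :
    ∃! π : ProbabilityMeasure K, IsStationaryDistribution P Y π := by
  have hprob : ∀ x k, IsProbabilityMeasure (P.map (Y x k)) := fun x k =>
    Measure.isProbabilityMeasure_map (hY x k).aemeasurable
  have hint : ∀ x k (f : K → ℝ), (∀ u v, |f u - f v| ≤ ‖u - v‖) →
      ∫ u, f u ∂(P.map (Y x k)) = ∫ ω, f (Y x k ω) ∂P := fun x k f hf =>
    integral_map (hY x k).aemeasurable
      (continuous_of_abs_sub_le_norm hf).measurable.aestronglyMeasurable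
  let μ : K → ℕ → ProbabilityMeasure K := fun x k => ⟨P.map (Y x k), hprob x k⟩
  have hcauchy : ∀ x, ∀ ε > 0, ∃ N, ∀ k ≥ N, ∀ l,
      dL (P.map (Y x (k + l))) (P.map (Y x k)) ≤ ε := by
    intro x ε hε
    have hε3 : 0 < ε / 3 := by positivity
    obtain ⟨R, hR0, hR⟩ := hP1.exists_radius hY x hε3
    -- The ball must contain the starting point `x` as well as `Y x l` with high probability.
    set r := max R ‖x‖
    obtain ⟨N, hN⟩ := eventually_atTop.1 (hP2.eventually_abs_integral_sub_le hY
      (Metric.isBounded_closedBall (x := (0 : K)) (r := r)) hε3)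
    refine ⟨N, fun k hk l => dL_le fun f hf h1 => ?_⟩
    have hfm := (continuous_of_abs_sub_le_norm hf).measurable
    have hum := hmeas k f hfm h1
    set u : K → ℝ := fun y => ∫ ω, f (Y y k ω) ∂P with hu
    have hu1 : ∀ y, |u y| ≤ 1 := fun y => abs_integral_le_one fun ω => h1 _
    have hbad : MeasurableSet {ω | r < ‖Y x l ω‖} :=
      measurableSet_lt measurable_const (hY x l).norm
    have hui : Integrable (fun ω => u (Y x l ω)) P :=
      integrable_of_measurable_of_abs_le_one (hum.comp (hY x l)) fun ω => hu1 _
    rw [hint _ _ f hf, hint _ _ f hf, hmarkov k l x f hfm h1]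
    change |∫ ω, u (Y x l ω) ∂P - u x| ≤ ε
    have hsub : ∫ ω, u (Y x l ω) ∂P - u x = ∫ ω, (u (Y x l ω) - u x) ∂P := by
      rw [integral_sub hui (integrable_const _)]
      simp
    -- Inside the ball (P2) applies; outside, an event of probability at most `ε / 3`, only `|u| ≤
    -- 1` is used.
    have hpt : ∀ ω, |u (Y x l ω) - u x| ≤
        ε / 3 + {ω | r < ‖Y x l ω‖}.indicator (fun _ => (2 : ℝ)) ω := by
      intro ω
      by_cases hω : r < ‖Y x l ω‖
      · rw [Set.indicator_of_mem (by exact hω)]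
        have ha := abs_le.1 (hu1 (Y x l ω))
        have hb := abs_le.1 (hu1 x)
        exact abs_le.2 ⟨by linarith, by linarith⟩
      · rw [Set.indicator_of_notMem (by exact hω), add_zero]
        exact hN k hk f hf h1 _ (by simpa using not_lt.1 hω) _ (by simp [r])
    rw [hsub]
    calc |∫ ω, (u (Y x l ω) - u x) ∂P| ≤ ∫ ω, |u (Y x l ω) - u x| ∂P :=
          abs_integral_le_integral_abs
      _ ≤ ∫ ω, (ε / 3 + {ω | r < ‖Y x l ω‖}.indicator (fun _ => (2 : ℝ)) ω) ∂P :=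
          integral_mono (hui.sub (integrable_const _)).abs
            ((integrable_const _).add ((integrable_const _).indicator hbad)) hpt
      _ = ε / 3 + P.real {ω | r < ‖Y x l ω‖} * 2 := by
          rw [integral_add (integrable_const _) ((integrable_const _).indicator hbad),
            integral_indicator_const _ hbad]
          simp
      _ ≤ ε / 3 + ε / 3 * 2 := by
          gcongr
          exact ENNReal.toReal_le_of_le_ofReal hε3.le (hR r (le_max_left _ _) l)
      _ = ε := by ring
  have htight : ∀ x, IsTightMeasureSet (Set.range fun k => (μ x k : Measure K)) := by
    intro x
    refine isTightMeasureSet_of_tendsto_measure_norm_gt (ENNReal.tendsto_nhds_zero.2 fun ε hε => ?_)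
    obtain ⟨δ, hδ0, hδ⟩ : ∃ δ : ℝ, 0 < δ ∧ ENNReal.ofReal δ ≤ ε := by
      obtain ⟨δ, hδ0, hδ⟩ := ENNReal.lt_iff_exists_nnreal_btwn.1 hε
      exact ⟨δ, by simpa using hδ0, by simpa using hδ.le⟩
    obtain ⟨R, -, hR⟩ := hP1.exists_radius hY x hδ0
    filter_upwards [eventually_ge_atTop R] with r hr
    refine iSup₂_le ?_
    rintro _ ⟨k, rfl⟩
    refine le_trans (le_of_eq ?_) ((hR r hr k).trans hδ)
    exact Measure.map_apply (hY x k) (measurableSet_lt measurable_const measurable_norm)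
  obtain ⟨π, hπ⟩ := exists_tendsto_dL (htight 0) (hcauchy 0)
  refine ⟨π, fun x => ?_, fun π' hπ' => ?_⟩
  · refine Metric.tendsto_atTop.2 fun ε hε => ?_
    have hε3 : 0 < ε / 3 := by positivity
    have hbdd : Bornology.IsBounded ({x, 0} : Set K) := (Set.toFinite _).isBounded
    obtain ⟨N, hN⟩ := eventually_atTop.1
      ((hP2.eventually_abs_integral_sub_le hY hbdd hε3).and (hπ.eventually_le_const hε3))
    refine ⟨N, fun k hk => ?_⟩
    rw [Real.dist_eq, sub_zero, abs_of_nonneg (dL_nonneg _ _)]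
    refine lt_of_le_of_lt (dL_le (c := ε / 3 + ε / 3) fun f hf h1 => ?_) (by linarith)
    have ha := (hN k hk).1 f hf h1 x (by simp) 0 (by simp)
    have hb := (abs_integral_sub_le_dL (μ 0 k : Measure K) π hf h1).trans (hN k hk).2
    change |∫ u, f u ∂(P.map (Y 0 k)) - _| ≤ _ at hb
    rw [hint _ _ f hf] at hb ⊢
    exact (abs_sub_le _ _ _).trans (add_le_add ha hb)
  · exact tendsto_nhds_unique (tendsto_of_tendsto_dL (μ := μ 0) (hπ' 0)) (tendsto_of_tendsto_dL hπ)

end MarkovChain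

/-! ### Increments of the cylindrical Wiener process. -/

section Noise

variable {H : Type*} [NormedAddCommGroup H] [InnerProductSpace ℝ H]
  {Ω : Type*} {mΩ : MeasurableSpace Ω} {P : Measure Ω}
  {𝓕 : Filtration ℝ≥0 mΩ} {W : ℝ≥0 → H → Ω → ℝ}

theorem IsCylindricalWiener.measurable (hW : IsCylindricalWiener 𝓕 P W) (t : ℝ≥0) (h : H) :
    Measurable (W t h) :=
  (hW.adapted t h).mono (𝓕.le t) le_rfl

theorem IsCylindricalWiener.ae_sum (hW : IsCylindricalWiener 𝓕 P W) (t : ℝ≥0) {ι : Type*}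
    (s : Finset ι) (a : ι → ℝ) (g : ι → H) :
    ∀ᵐ ω ∂P, W t (∑ i ∈ s, a i • g i) ω = ∑ i ∈ s, a i * W t (g i) ω := by
  classical
  induction s using Finset.induction_on with
  | empty =>
    -- Linearity at zero reads `W t 0 = W t 0 + W t 0`, so `W t 0` vanishes almost surely.
    filter_upwards [hW.linear t 1 0 0] with ω hω
    simpa using hω
  | insert i s hi ih =>
    filter_upwards [ih, hW.linear t (a i) (g i) (∑ i ∈ s, a i • g i)] with ω h1 h2
    rw [Finset.sum_insert hi, Finset.sum_insert hi, h2, h1]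

/-- The joint law of the coordinates of an increment depends only on its duration. -/
theorem IsCylindricalWiener.map_increment_eq [IsProbabilityMeasure P]
    (hW : IsCylindricalWiener 𝓕 P W) {ι : Type*} (g : ι → H) {s t s' t' : ℝ≥0} (hst : s ≤ t)
    (hst' : s' ≤ t') (h : t - s = t' - s') :
    P.map (fun ω i => W t (g i) ω - W s (g i) ω) =
      P.map (fun ω i => W t' (g i) ω - W s' (g i) ω) := by
  classical
  have hm : ∀ (t s : ℝ≥0) (i : ι), Measurable fun ω => W t (g i) ω - W s (g i) ω :=
    fun t s i => (hW.measurable t _).sub (hW.measurable s _)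
  rw [map_eq_iff_forall_finset_map_restrict_eq (measurable_pi_lambda _ (hm t s)).aemeasurable
    (measurable_pi_lambda _ (hm t' s')).aemeasurable]
  intro I
  have hmI : ∀ t s : ℝ≥0, Measurable fun (ω : Ω) (i : I) => W t (g i) ω - W s (g i) ω :=
    fun t s => measurable_pi_lambda _ fun i => hm t s i
  -- By linearity of `W`, a functional of finitely many coordinates is almost surely the increment
  -- in a single direction, hence Gaussian. These one-dimensional laws determine the joint law
  -- through its characteristic functional.
  have hL : ∀ {s t : ℝ≥0}, s ≤ t → ∀ L : StrongDual ℝ (I → ℝ),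
      (P.map fun (ω : Ω) (i : I) => W t (g i) ω - W s (g i) ω).map L =
        gaussianReal 0 ((t - s) * ‖∑ i : I, L (Pi.single i 1) • g i‖₊ ^ 2) := by
    intro s t hst L
    rw [← hW.gaussian s t hst, Measure.map_map L.continuous.measurable (hmI t s)]
    refine Measure.map_congr ?_
    filter_upwards [hW.ae_sum t Finset.univ (fun i : I => L (Pi.single i 1)) fun i => g i,
      hW.ae_sum s Finset.univ (fun i : I => L (Pi.single i 1)) fun i => g i] with ω h1 h2
    rw [h1, h2, ← Finset.sum_sub_distrib]
    refine (LinearMap.pi_apply_eq_sum_univ L.toLinearMap _).trans ?_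
    refine Finset.sum_congr rfl fun i _ => ?_
    have : (fun j => if i = j then (1 : ℝ) else 0) = Pi.single i 1 := by
      ext j
      simp [Pi.single_apply, eq_comm]
    simp [this]
    ring
  change P.map (fun (ω : Ω) (i : I) => W t (g i) ω - W s (g i) ω) =
    P.map (fun (ω : Ω) (i : I) => W t' (g i) ω - W s' (g i) ω)
  have := Measure.isProbabilityMeasure_map (μ := P) (hmI t s).aemeasurable
  have := Measure.isProbabilityMeasure_map (μ := P) (hmI t' s').aemeasurable
  refine Measure.ext_of_charFunDual (funext fun L => ?_)
  rw [charFunDual_eq_charFun_map_one, charFunDual_eq_charFun_map_one, hL hst, hL hst', h]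

end Noise

/-! ### Measurability, adaptedness and independence for the scheme. -/

section Scheme

variable {H : Type*} [NormedAddCommGroup H] [InnerProductSpace ℝ H]

theorem CoefficientAssumption.continuous_b {e : HilbertBasis ℕ ℝ H} {b : H → H}
    {σ₁ : H → H →L[ℝ] H} (h : CoefficientAssumption e b σ₁) : Continuous b := by
  obtain ⟨L, hL0, hL⟩ := h.lipschitz_b
  exact (LipschitzWith.of_dist_le_mul (K := ⟨L, hL0.le⟩) fun x y => by
    rw [dist_eq_norm, dist_eq_norm]; exact hL x y).continuous

/-- One term of the Hilbert–Schmidt sum is at most the whole sum. -/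
theorem CoefficientAssumption.continuous_σ₁_apply {e : HilbertBasis ℕ ℝ H} {b : H → H}
    {σ₁ : H → H →L[ℝ] H} (h : CoefficientAssumption e b σ₁) (j : ℕ) :
    Continuous fun x => σ₁ x (e j) := by
  obtain ⟨L, hL0, hL⟩ := h.lipschitz_σ₁
  refine (LipschitzWith.of_dist_le_mul (K := ⟨L, hL0.le⟩) fun x y => ?_).continuous
  have h1 : ‖(σ₁ x - σ₁ y) (e j)‖ₑ ^ 2 ≤ ENNReal.ofReal ((L * ‖x - y‖) ^ 2) :=
    (ENNReal.le_tsum j).trans (hL x y)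
  rw [← ofReal_norm, ← ENNReal.ofReal_pow (norm_nonneg _),
    ENNReal.ofReal_le_ofReal_iff (by positivity)] at h1
  rw [dist_eq_norm, dist_eq_norm]
  exact le_of_sq_le_sq h1 (by positivity)

variable {Ω : Type*} {mΩ : MeasurableSpace Ω}

/-- The coordinates in the basis `e` of the `k`-th increment of the driving noise. -/
noncomputable def noiseIncrement (e : HilbertBasis ℕ ℝ H) (W : ℝ≥0 → H → Ω → ℝ) (Δ : ℝ≥0) (k : ℕ)
    (ω : Ω) (j : ℕ) : ℝ :=
  W ((k + 1 : ℕ) * Δ) (e j) ω - W (k * Δ) (e j) ω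

/-- One step of the scheme, as a function of the current state and the coordinates of the
increment of the noise. -/
noncomputable def schemeStep (A : H →ₗ.[ℝ] H) (e : HilbertBasis ℕ ℝ H)
    (he : ∀ i, e i ∈ A.domain) (b : H → H) (σ : H → H →L[ℝ] H) (n : ℕ) (Δ : ℝ≥0)
    (p : Hn e n × (ℕ → ℝ)) : Hn e n :=
  opExp ((Δ : ℝ) • An A e he n) (p.1 + (Δ : ℝ) • proj e n (b p.1) +
    limUnder atTop fun m => ∑ j ∈ Finset.range m, p.2 j • proj e n (σ p.1 (e j)))

theorem scheme_succ (A : H →ₗ.[ℝ] H) (e : HilbertBasis ℕ ℝ H) (he : ∀ i, e i ∈ A.domain)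
    (b : H → H) (σ : H → H →L[ℝ] H) (W : ℝ≥0 → H → Ω → ℝ) (n : ℕ) (Δ : ℝ≥0) (x : Hn e n) (k : ℕ)
    (ω : Ω) :
    scheme A e he b σ W n Δ x (k + 1) ω =
      schemeStep A e he b σ n Δ (scheme A e he b σ W n Δ x k ω, noiseIncrement e W Δ k ω) :=
  rfl

variable {P : Measure Ω} {𝓕 : Filtration ℝ≥0 mΩ} {W : ℝ≥0 → H → Ω → ℝ}

theorem IsCylindricalWiener.measurable_noiseIncrement (hW : IsCylindricalWiener 𝓕 P W)
    (e : HilbertBasis ℕ ℝ H) (Δ : ℝ≥0) (k : ℕ) :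
    Measurable[𝓕 ((k + 1 : ℕ) * Δ)] (noiseIncrement e W Δ k) := by
  refine @measurable_pi_lambda _ _ _ (𝓕 _) _ _ fun j =>
    (hW.adapted _ _).sub ((hW.adapted _ _).mono ?_ le_rfl)
  exact 𝓕.mono (by gcongr; omega)

variable [MeasurableSpace H] [BorelSpace H]

/-- `limUnder` of a sequence of measurable maps is measurable whether or not the sequence converges,
so convergence of the noise series plays no role. -/
theorem measurable_applyNoise {e : HilbertBasis ℕ ℝ H} {n : ℕ} {σ : H → H →L[ℝ] H}
    (hσ : ∀ j, Continuous fun x => σ x (e j)) :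
    Measurable fun p : Hn e n × (ℕ → ℝ) =>
      limUnder atTop fun m => ∑ j ∈ Finset.range m, p.2 j • proj e n (σ p.1 (e j)) := by
  have : ProperSpace (Hn e n) := FiniteDimensional.proper_real _
  refine (StronglyMeasurable.limUnder fun m => Measurable.stronglyMeasurable ?_).measurable
  refine Finset.measurable_sum _ fun j _ => ?_
  have h1 : Measurable fun p : Hn e n × (ℕ → ℝ) => p.2 j := by fun_prop
  have h2 : Measurable fun p : Hn e n × (ℕ → ℝ) => proj e n (σ p.1 (e j)) :=
    (((proj e n).continuous.comp (hσ j)).comp continuous_subtype_val).measurable.comp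
      measurable_fst
  exact h1.smul h2

theorem measurable_schemeStep {A : H →ₗ.[ℝ] H} {e : HilbertBasis ℕ ℝ H}
    {he : ∀ i, e i ∈ A.domain} {b : H → H} {σ : H → H →L[ℝ] H} {n : ℕ} {Δ : ℝ≥0}
    (hb : Continuous b) (hσ : ∀ j, Continuous fun x => σ x (e j)) :
    Measurable (schemeStep A e he b σ n Δ) := by
  have : ProperSpace (Hn e n) := FiniteDimensional.proper_real _
  refine (opExp ((Δ : ℝ) • An A e he n)).continuous.measurable.comp
    (Measurable.add ?_ (measurable_applyNoise hσ))
  have hp : Continuous fun y : Hn e n => proj e n (b y) :=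
    (proj e n).continuous.comp (hb.comp continuous_subtype_val)
  have h : Continuous fun y : Hn e n => y + (Δ : ℝ) • proj e n (b y) := by
    fun_prop
  exact h.measurable.comp measurable_fst

theorem IsCylindricalWiener.adapted_scheme (hW : IsCylindricalWiener 𝓕 P W) {A : H →ₗ.[ℝ] H}
    {e : HilbertBasis ℕ ℝ H} {he : ∀ i, e i ∈ A.domain} {b : H → H} {σ : H → H →L[ℝ] H} {n : ℕ}
    {Δ : ℝ≥0} (hb : Continuous b) (hσ : ∀ j, Continuous fun x => σ x (e j)) (x : Hn e n) (k : ℕ) :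
    Measurable[𝓕 (k * Δ)] (scheme A e he b σ W n Δ x k) := by
  induction k with
  | zero => exact measurable_const
  | succ k ih =>
    exact (measurable_schemeStep (he := he) (Δ := Δ) hb hσ).comp
      ((ih.mono (𝓕.mono (by gcongr; omega)) le_rfl).prodMk (hW.measurable_noiseIncrement e Δ k))

theorem IsCylindricalWiener.indepFun_scheme (hW : IsCylindricalWiener 𝓕 P W) {A : H →ₗ.[ℝ] H}
    {e : HilbertBasis ℕ ℝ H} {he : ∀ i, e i ∈ A.domain} {b : H → H} {σ : H → H →L[ℝ] H} {n : ℕ}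
    {Δ : ℝ≥0} (hb : Continuous b) (hσ : ∀ j, Continuous fun x => σ x (e j)) (x : Hn e n) (k : ℕ) :
    IndepFun (scheme A e he b σ W n Δ x k) (noiseIncrement e W Δ k) P := by
  have hind := hW.indep (k * Δ) ((k + 1 : ℕ) * Δ) (by gcongr; omega)
  refine indep_of_indep_of_le_left (indep_of_indep_of_le_right hind.symm ?_)
    (hW.adapted_scheme hb hσ x k).comap_le
  -- The basis coordinates are a measurable function of the full family of coordinates, which is
  -- independent of the past.
  have hg : Measurable fun (z : H → ℝ) (j : ℕ) => z (e j) := by fun_prop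
  change MeasurableSpace.comap ((fun (z : H → ℝ) (j : ℕ) => z (e j)) ∘
    fun ω h => W ((k + 1 : ℕ) * Δ) h ω - W (k * Δ) h ω) _ ≤ _
  rw [← MeasurableSpace.comap_comp]
  exact MeasurableSpace.comap_mono hg.comap_le

end Scheme
end EIScheme

theorem mainTheorem1
    {H : Type*} [NormedAddCommGroup H] [InnerProductSpace ℝ H] [CompleteSpace H]
    [MeasurableSpace H] [BorelSpace H]
    {Ω : Type*} {mΩ : MeasurableSpace Ω} (P : Measure Ω) [IsProbabilityMeasure P]
    (𝓕 : Filtration ℝ≥0 mΩ)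
    (A : H →ₗ.[ℝ] H) (S : ℝ≥0 → H →L[ℝ] H) (lam : ℕ → ℝ) (e : HilbertBasis ℕ ℝ H)
    (hA : EIScheme.LinearPartAssumption A S lam e)
    (b : H → H) (σ₀ : H →L[ℝ] H) (σ₁ : H → H →L[ℝ] H)
    (hbσ : EIScheme.CoefficientAssumption e b σ₁)
    (W : ℝ≥0 → H → Ω → ℝ) (hW : EIScheme.IsCylindricalWiener 𝓕 P W)
    (n : ℕ) (Δ : ℝ≥0) (hΔ₀ : 0 < Δ) (hΔ₁ : Δ < 1)
    (hP1 : EIScheme.PropertyP1 P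
      (EIScheme.scheme A e hA.eigen_mem b (fun x => σ₀ + σ₁ x) W n Δ))
    (hP2 : EIScheme.PropertyP2 P
      (EIScheme.scheme A e hA.eigen_mem b (fun x => σ₀ + σ₁ x) W n Δ)) :
    ∃! π : ProbabilityMeasure (EIScheme.Hn e n),
      EIScheme.IsStationaryDistribution P
        (EIScheme.scheme A e hA.eigen_mem b (fun x => σ₀ + σ₁ x) W n Δ) π := by
  have hb := hbσ.continuous_b
  have hσ : ∀ j, Continuous fun x => (σ₀ + σ₁ x) (e j) := fun j =>
    continuous_const.add (hbσ.continuous_σ₁_apply j)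
  have : ProperSpace (EIScheme.Hn e n) := FiniteDimensional.proper_real _
  have hY := fun x k => (hW.adapted_scheme (he := hA.eigen_mem) (Δ := Δ) (n := n) hb hσ x k).mono
    (𝓕.le _) le_rfl
  have hξ := fun k => (hW.measurable_noiseIncrement e Δ k).mono (𝓕.le _) le_rfl
  have hlaw : ∀ k, P.map (EIScheme.noiseIncrement e W Δ k) =
      P.map (EIScheme.noiseIncrement e W Δ 0) := fun k =>
    hW.map_increment_eq (fun j => e j) (by gcongr; omega) (by gcongr; omega)
      (by simp [← tsub_mul])
  have hmarkov := EIScheme.markov_of_random_iteration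
    (EIScheme.measurable_schemeStep (he := hA.eigen_mem) (Δ := Δ) (n := n) hb hσ) hξ hY
    (fun _ _ => rfl) (EIScheme.scheme_succ A e hA.eigen_mem b _ W n Δ) hlaw
    (hW.indepFun_scheme hb hσ)
  exact EIScheme.existsUnique_isStationaryDistribution hY
    (fun k f hf h1 => (hmarkov k hf h1).1) (fun k l x f hf h1 => (hmarkov k hf h1).2 l x) hP1 hP2
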